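/- Let $\Gamma_+=\{\lambda\in\mathbb R^n:\lambda_i>0\ \forall i\}$ and let $\alpha>\tfrac12$. Let $\gamma:\Gamma_+\to(0,\infty)$ be a smooth symmetric function which is $\alpha$-homogeneous ($\gamma(c\lambda)=c^\alpha\gamma(\lambda)$ for all $c>0$), satisfies $\partial\gamma/\partial\lambda_i>0$ on $\Gamma_+$ for every $i$, and has a continuous extension to $\overline{\Gamma_+}$ that vanishes on $\partial\Gamma_+$. A smooth hypersurface of $\mathbb R^{n+1}$ with unit normal $\nu$ and principal curvatures $\lambda=(\lambda_1,\dots,\lambda_n)$ with respect to $\nu$ is called a strictly convex $\gamma$-translator if $\lambda\in\Gamma_+$ (so that $\nu$ is the inward normal) and $\gamma(\lambda)=\langle\nu,e_{n+1}\rangle$ at every point. A bowl-type $\gamma$-translator defined over a ball is a complete strictly convex $\gamma$-translator that is the graph of a function over a ball $B^n_R(0)$, $R>0$, and is rotationally symmetric about the $x_{n+1}$-axis. Let $\Sigma\subset\mathbb R^{n+1}$ be a complete strictly convex $\gamma$-translator that is the graph of a smooth function over a ball $B^n_r(0)$, $r>0$, and that has a single end, $\mathcal C^2$-asymptotic to the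 cylinder $\mathbb S^{n-1}(r)\times\mathbb R$, in the sense that, with $\lambda_1(p)\le\dots\le\lambda_n(p)$ the ordered principal curvatures, $$\lambda_1(p)\to0,\qquad \lambda_i(p)\to\frac1r\quad(i=2,\dots,n)\qquad\text{as }|p|\to\infty,\ p\in\Sigma.$$ Suppose that the bowl-type $\gamma$-translator is defined over a ball $B^n_R(0)$ for some $R>0$. Then $\Sigma$ coincides with the bowl-type $\gamma$-translator up to a vertical translation: for every bowl-type $\gamma$-translator $C$ defined over a ball there is $c\in\mathbb R$ with $\Sigma=C+c\,e_{n+1}$. -/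

import Mathlib

open Set Filter Topology Metric
open scoped ContDiff

noncomputable section

/-- The base space `ℝⁿ` with its Euclidean norm. -/
abbrev BaseSpace (n : ℕ) := EuclideanSpace ℝ (Fin n)

/-- The ambient space `ℝⁿ⁺¹` with its Euclidean inner product. -/
abbrev AmbientSpace (n : ℕ) := EuclideanSpace ℝ (Fin (n + 1))

/-- The point `(x, t) = (x₁, …, xₙ, t)` of `ℝⁿ⁺¹`. -/
def ambientPoint {n : ℕ} (x : BaseSpace n) (t : ℝ) : AmbientSpace n :=
  WithLp.toLp 2 (Fin.snoc (α := fun _ => ℝ) (fun i => x i) t)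

/-- The vertical unit vector `e_{n+1}`. -/
def verticalVec (n : ℕ) : AmbientSpace n :=
  EuclideanSpace.single (Fin.last n) 1

/-! ### Curvature functions -/

/-- The open positive cone `Γ₊` of `ℝⁿ`. -/
def positiveCone (n : ℕ) : Set (Fin n → ℝ) := {k | ∀ i, 0 < k i}

/-- `γ` is, on the positive cone, a positive smooth symmetric function, homogeneous of degree `α`,
strictly increasing in each argument (positive partial derivatives), with a continuous extension
to the closed cone which vanishes on the boundary. Values of `γ` off the cone are irrelevant. -/
structure IsCurvatureFunction {n : ℕ} (γ : (Fin n → ℝ) → ℝ) (α : ℝ) : Prop where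
  pos : ∀ k ∈ positiveCone n, 0 < γ k
  smooth : ContDiffOn ℝ ∞ γ (positiveCone n)
  symm : ∀ k ∈ positiveCone n, ∀ σ : Equiv.Perm (Fin n), γ (fun i => k (σ i)) = γ k
  homogeneous : ∀ k ∈ positiveCone n, ∀ c : ℝ, 0 < c → γ (c • k) = c ^ α * γ k
  increasing : ∀ k ∈ positiveCone n, ∀ i : Fin n, 0 < fderiv ℝ γ k (Pi.single i 1)
  extension : ∃ g : (Fin n → ℝ) → ℝ, ContinuousOn g (closure (positiveCone n)) ∧
    EqOn g γ (positiveCone n) ∧ ∀ k ∈ frontier (positiveCone n), g k = 0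

/-! ### Parametrized hypersurfaces `F : U ⊆ ℝⁿ → ℝⁿ⁺¹` -/

/-- The coordinate derivative `∂ᵢF` at `x`. -/
def coordDeriv {n : ℕ} (F : BaseSpace n → AmbientSpace n) (i : Fin n) (x : BaseSpace n) :
    AmbientSpace n :=
  fderiv ℝ F x (EuclideanSpace.single i 1)

/-- The metric coefficients `g_{ij} = ⟨∂ᵢF, ∂ⱼF⟩`. -/
def metricMatrix {n : ℕ} (F : BaseSpace n → AmbientSpace n) (x : BaseSpace n) :
    Matrix (Fin n) (Fin n) ℝ :=
  Matrix.of fun i j => inner ℝ (coordDeriv F i x) (coordDeriv F j x)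

/-- The coefficients `h_{ij} = ⟨∂ᵢ∂ⱼF, ν⟩` of the second fundamental form with respect to the unit
normal `ν`; with this sign a round sphere has positive curvatures for its inward normal. -/
def secondFormMatrix {n : ℕ} (F : BaseSpace n → AmbientSpace n) (ν : AmbientSpace n)
    (x : BaseSpace n) : Matrix (Fin n) (Fin n) ℝ :=
  Matrix.of fun i j => inner ℝ (coordDeriv (coordDeriv F j) i x) ν

/-- The Weingarten matrix `hⁱⱼ = gⁱᵏ h_{kj}`. -/
def weingartenMatrix {n : ℕ} (F : BaseSpace n → AmbientSpace n) (ν : AmbientSpace n)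
    (x : BaseSpace n) : Matrix (Fin n) (Fin n) ℝ :=
  (metricMatrix F x)⁻¹ * secondFormMatrix F ν x

/-- `ν` is a unit normal of `F` at `x`. -/
def IsUnitNormal {n : ℕ} (F : BaseSpace n → AmbientSpace n) (x : BaseSpace n)
    (ν : AmbientSpace n) : Prop :=
  ‖ν‖ = 1 ∧ ∀ v : BaseSpace n, inner ℝ (fderiv ℝ F x v) ν = 0

/-- `k` lists the principal curvatures of `F` at `x` with respect to `ν`, that is, the eigenvalues
of the Weingarten matrix with multiplicity. -/
def IsPrincipalCurvatureVector {n : ℕ} (F : BaseSpace n → AmbientSpace n) (ν : AmbientSpace n)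
    (x : BaseSpace n) (k : Fin n → ℝ) : Prop :=
  (weingartenMatrix F ν x).charpoly = ∏ i, (Polynomial.X - Polynomial.C (k i))

/-- The hypersurface `F` over `U`, with unit normal field `ν`, is a strictly convex
`γ`-translator: its principal curvatures with respect to `ν` are positive (so that `ν` is the
inward normal) and satisfy `γ(λ) = ⟨ν, e_{n+1}⟩`. -/
structure IsStrictlyConvexTranslator {n : ℕ} (γ : (Fin n → ℝ) → ℝ)
    (F : BaseSpace n → AmbientSpace n) (ν : BaseSpace n → AmbientSpace n)
    (U : Set (BaseSpace n)) : Prop where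
  continuousOn_normal : ContinuousOn ν U
  isUnitNormal : ∀ x ∈ U, IsUnitNormal F x (ν x)
  equation : ∀ x ∈ U, ∃ k : Fin n → ℝ, IsPrincipalCurvatureVector F (ν x) x k ∧
    k ∈ positiveCone n ∧ γ k = inner ℝ (ν x) (verticalVec n)

/-! ### Subsets of `ℝⁿ⁺¹` -/

/-- Completeness for the induced length metric: every half-open path in `S` of finite length
converges to a point of `S`. -/
def IsLengthComplete {n : ℕ} (S : Set (AmbientSpace n)) : Prop :=
  ∀ c : ℝ → AmbientSpace n, ContinuousOn c (Ico 0 1) → MapsTo c (Ico 0 1) S →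
    eVariationOn c (Ico 0 1) ≠ ⊤ → ∃ p ∈ S, Tendsto c (𝓝[<] 1) (𝓝 p)

/-- `S` has exactly one end: outside arbitrarily large compact sets it is non-empty and
connected. -/
def HasSingleEnd {n : ℕ} (S : Set (AmbientSpace n)) : Prop :=
  ∀ K : Set (AmbientSpace n), IsCompact K →
    ∃ K' : Set (AmbientSpace n), IsCompact K' ∧ K ⊆ K' ∧ IsConnected (S \ K')

/-- Invariance under all orthogonal maps of `ℝⁿ⁺¹` fixing the `x_{n+1}`-axis. -/
def IsRotationallySymmetric {n : ℕ} (S : Set (AmbientSpace n)) : Prop :=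
  ∀ A : BaseSpace n ≃ₗᵢ[ℝ] BaseSpace n, ∀ (x : BaseSpace n) (t : ℝ),
    ambientPoint x t ∈ S → ambientPoint (A x) t ∈ S

/-- The translate of `S` by `c e_{n+1}`. -/
def verticalTranslate {n : ℕ} (c : ℝ) (S : Set (AmbientSpace n)) : Set (AmbientSpace n) :=
  (fun p => p + c • verticalVec n) '' S

/-! ### Graphs over balls -/

/-- The graph parametrization `x ↦ (x, u(x))`. -/
def graphMap {n : ℕ} (u : BaseSpace n → ℝ) (x : BaseSpace n) : AmbientSpace n :=
  ambientPoint x (u x)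

/-- The graph of `u` over the open ball `B_r(0)`. -/
def graphOverBall {n : ℕ} (r : ℝ) (u : BaseSpace n → ℝ) : Set (AmbientSpace n) :=
  graphMap u '' ball 0 r

/-- The graph of `u` over `B_r(0)`, with inward unit normal `ν`, is a complete strictly convex
smooth `γ`-translator. -/
structure IsCompleteConvexTranslatorGraph {n : ℕ} (γ : (Fin n → ℝ) → ℝ) (r : ℝ)
    (u : BaseSpace n → ℝ) (ν : BaseSpace n → AmbientSpace n) : Prop where
  radius_pos : 0 < r
  smooth : ContDiffOn ℝ ∞ u (ball 0 r)
  translator : IsStrictlyConvexTranslator γ (graphMap u) ν (ball 0 r)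
  complete : IsLengthComplete (graphOverBall r u)

/-- The graph of `u` over `B_r(0)` is `C²`-asymptotic to the cylinder `𝕊ⁿ⁻¹(r) × ℝ`: as `|p| → ∞`
the smallest principal curvature tends to `0` and all the others tend to `1 / r`. -/
def IsAsymptoticToCylinder {n : ℕ} (r : ℝ) (u : BaseSpace n → ℝ)
    (ν : BaseSpace n → AmbientSpace n) : Prop :=
  ∀ ε > 0, ∃ M : ℝ, ∀ x ∈ ball (0 : BaseSpace n) r, M ≤ ‖graphMap u x‖ →
    ∀ k : Fin n → ℝ, Monotone k → IsPrincipalCurvatureVector (graphMap u) (ν x) x k →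
      ∀ i : Fin n, |k i - (if i.val = 0 then 0 else 1 / r)| < ε

/-- The graph of `w` over `B_R(0)` is a bowl-type `γ`-translator defined over a ball: a complete
rotationally symmetric strictly convex `γ`-translator. -/
def IsBowlOverBall {n : ℕ} (γ : (Fin n → ℝ) → ℝ) (R : ℝ) (w : BaseSpace n → ℝ) : Prop :=
  (∃ μ : BaseSpace n → AmbientSpace n, IsCompleteConvexTranslatorGraph γ R w μ) ∧
    IsRotationallySymmetric (graphOverBall R w)

end

/-! Homogeneity takes the place of the strong maximum principle. For `s < 1` the dilated function `s
* f (s⁻¹ • y)` has the gradients of `f` at the corresponding points and its curvatures multiplied by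
`s⁻¹`. Hence `γ` exceeds the vertical component of the normal by the factor `s⁻¹ ^ α > 1`. Such a
strict subsolution cannot touch a translator from below (`not_isLocalMin_sub_dilation`), because
ordered eigenvalues and `γ` are monotone. Letting `s → 1` gives the comparison principle
`le_sub_of_le_sub_boundary`.

Convexity and completeness make a translator over a ball blow up uniformly at the boundary sphere
(`exists_radius_forall_lt`). This is the only boundary behaviour needed for Alexandrov reflection: a
cap is compared with its mirror image, with equality on the flat face and blow-up deciding near the
sphere. So every complete translator over a ball is radial
(`IsCompleteConvexTranslatorGraph.eq_of_norm_eq`).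

Two such translators live over the same ball: otherwise their difference would blow up at the
boundary of the smaller ball and contradict comparison. Over the same ball the difference is
constant on spheres, so comparison on a smaller ball bounds its value at the center below by its
value on the bounding sphere. Exchanging the two functions shows that it is constant. -/

/-! ### Eigenvalues of pairs of quadratic forms, and monotonicity of `γ`. -/

lemma exists_perm_comp_eq_of_map_univ_eq {m : ℕ} {f g : Fin m → ℝ}
    (h : Finset.univ.val.map f = Finset.univ.val.map g) :
    ∃ σ : Equiv.Perm (Fin m), f ∘ σ = g := by
  have hp : (List.ofFn f).Perm (List.ofFn g) := by
    rw [Fin.univ_val_map, Fin.univ_val_map] at h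
    exact Multiset.coe_eq_coe.1 h
  have hs : (List.ofFn (f ∘ Tuple.sort f)).Perm (List.ofFn (g ∘ Tuple.sort g)) :=
    (Equiv.Perm.ofFn_comp_perm (Tuple.sort f) f).trans
      (hp.trans (Equiv.Perm.ofFn_comp_perm (Tuple.sort g) g).symm)
  have he := List.ofFn_injective (hs.eq_of_sortedLE
    (List.sortedLE_ofFn_iff.2 (Tuple.monotone_sort f))
    (List.sortedLE_ofFn_iff.2 (Tuple.monotone_sort g)))
  refine ⟨(Tuple.sort g).symm.trans (Tuple.sort f), ?_⟩
  funext i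
  simpa using congrFun he ((Tuple.sort g).symm i)

open Matrix in
/-- Simultaneous diagonalization of a symmetric matrix and a positive definite one. -/
lemma exists_simultaneous_diagonalization {n : ℕ} {G H : Matrix (Fin n) (Fin n) ℝ}
    (hG : G.PosDef) (hH : H.IsHermitian) {k : Fin n → ℝ}
    (hk : (G⁻¹ * H).charpoly = ∏ i, (Polynomial.X - Polynomial.C (k i))) :
    ∃ σ : Equiv.Perm (Fin n), Monotone (k ∘ σ) ∧ ∃ W : Matrix (Fin n) (Fin n) ℝ,
      Wᵀ * G * W = 1 ∧ Wᵀ * H * W = diagonal (k ∘ σ) := by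
  obtain ⟨B, hB⟩ : ∃ B : Matrix (Fin n) (Fin n) ℝ, G = Bᵀ * B := by
    open scoped MatrixOrder in
    obtain ⟨B, hB⟩ := CStarAlgebra.nonneg_iff_eq_star_mul_self.mp hG.posSemidef.nonneg
    exact ⟨B, by rw [hB, star_eq_conjTranspose, conjTranspose_eq_transpose_of_trivial]⟩
  have hBu : IsUnit B.det := by
    have h1 := (isUnit_iff_isUnit_det G).1 hG.isUnit
    rw [hB, det_mul] at h1
    exact isUnit_of_mul_isUnit_right h1
  have hBi : B * B⁻¹ = 1 := mul_nonsing_inv B hBu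
  have hBit : (B⁻¹)ᵀ * Bᵀ = 1 := by rw [← transpose_mul, hBi, transpose_one]
  -- `A` is symmetric and has the characteristic polynomial of `G⁻¹ * H`, so the spectral theorem
  -- applies to it.
  set A := (B⁻¹)ᵀ * H * B⁻¹ with hAdef
  have hA : A.IsHermitian := by
    have := isHermitian_conjTranspose_mul_mul B⁻¹ hH
    rwa [conjTranspose_eq_transpose_of_trivial] at this
  have hcp : A.charpoly = ∏ i, (Polynomial.X - Polynomial.C (k i)) := by
    rw [← hk, hAdef, charpoly_mul_comm, hB, Matrix.mul_inv_rev, transpose_nonsing_inv, mul_assoc]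
  have hroots : Finset.univ.val.map k = Finset.univ.val.map hA.eigenvalues := by
    have h1 := hA.roots_charpoly_eq_eigenvalues
    rw [hcp, Polynomial.roots_prod _ _ (by
      simp [Finset.prod_ne_zero_iff, Polynomial.X_sub_C_ne_zero])] at h1
    simpa using h1
  obtain ⟨σ, hσ⟩ := exists_perm_comp_eq_of_map_univ_eq hroots
  set τ := Tuple.sort (k ∘ σ)
  set V : Matrix (Fin n) (Fin n) ℝ := ↑hA.eigenvectorUnitary with hV
  have hVV : Vᵀ * V = 1 := by
    have := Unitary.coe_star_mul_self hA.eigenvectorUnitary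
    rwa [star_eq_conjTranspose, conjTranspose_eq_transpose_of_trivial] at this
  have hVA : Vᵀ * A * V = diagonal (k ∘ σ) := by
    have h1 : A = V * diagonal hA.eigenvalues * Vᵀ := by
      have := hA.spectral_theorem
      rwa [Unitary.conjStarAlgAut_apply, star_eq_conjTranspose,
        conjTranspose_eq_transpose_of_trivial] at this
    rw [hσ]
    calc Vᵀ * A * V = (Vᵀ * V) * diagonal hA.eigenvalues * (Vᵀ * V) := by
          conv_lhs => rw [h1]
          simp only [mul_assoc]
      _ = _ := by rw [hVV, one_mul, mul_one]
  have hsub : ∀ M N : Matrix (Fin n) (Fin n) ℝ,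
      (N.submatrix id τ)ᵀ * M * N.submatrix id τ = (Nᵀ * M * N).submatrix τ τ := by
    intro M N
    ext i j
    simp [mul_apply, submatrix_apply]
  refine ⟨τ.trans σ, ?_, (B⁻¹ * V).submatrix id τ, ?_, ?_⟩
  · exact Tuple.monotone_sort (k ∘ σ)
  · rw [hsub, transpose_mul, hB]
    have : Vᵀ * (B⁻¹)ᵀ * (Bᵀ * B) * (B⁻¹ * V)
        = Vᵀ * ((B⁻¹)ᵀ * Bᵀ) * (B * B⁻¹) * V := by simp only [mul_assoc]
    rw [this, hBit, hBi, mul_one, mul_one, hVV, submatrix_one_equiv]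
  · rw [hsub, transpose_mul]
    have : Vᵀ * (B⁻¹)ᵀ * H * (B⁻¹ * V) = Vᵀ * A * V := by simp only [hAdef, mul_assoc]
    rw [this, hVA, submatrix_diagonal_equiv]
    rfl

/-- Monotonicity of ordered eigenvalues, for diagonal forms related by an isometry. -/
lemma le_of_diagonal_form_le {n : ℕ} {k l : Fin n → ℝ} (hk : Monotone k) (hl : Monotone l)
    (T : (Fin n → ℝ) →ₗ[ℝ] (Fin n → ℝ)) (hT : ∀ a, ∑ i, T a i ^ 2 = ∑ i, a i ^ 2)
    (h : ∀ a, ∑ i, l i * T a i ^ 2 ≤ ∑ i, k i * a i ^ 2) (i : Fin n) : l i ≤ k i := by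
  -- Min-max argument: `n - 1` linear conditions leave a nonzero `a` with `T a j = 0` for `j < i`
  -- and `a j = 0` for `j > i`. On it the two forms are at least `l i` and at most `k i` times the
  -- same square norm.
  let f : (Fin n → ℝ) →ₗ[ℝ] ({j : Fin n // j ≠ i} → ℝ) :=
    LinearMap.pi fun j => if j.1 < i then (LinearMap.proj j.1).comp T else LinearMap.proj j.1
  have hker : LinearMap.ker f ≠ ⊥ := by
    apply LinearMap.ker_ne_bot_of_finrank_lt
    have := i.pos
    simp only [Module.finrank_fintype_fun_eq_card, Fintype.card_subtype_compl, Fintype.card_fin,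
      Fintype.card_unique, ne_eq]
    omega
  obtain ⟨a, ha, ha0⟩ := (Submodule.ne_bot_iff _).1 hker
  have hfa : ∀ j : Fin n, j ≠ i → (if j < i then T a j else a j) = 0 := by
    intro j hj
    have := congrFun (LinearMap.mem_ker.1 ha) ⟨j, hj⟩
    simp only [f, LinearMap.pi_apply, Pi.zero_apply] at this
    split_ifs at this ⊢ <;> simpa using this
  have h1 : l i * ∑ j, T a j ^ 2 ≤ ∑ j, l j * T a j ^ 2 := by
    rw [Finset.mul_sum]
    refine Finset.sum_le_sum fun j _ => ?_
    rcases lt_or_ge j i with hj | hj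
    · have := hfa j hj.ne
      rw [if_pos hj] at this
      simp [this]
    · exact mul_le_mul_of_nonneg_right (hl hj) (sq_nonneg _)
  have h2 : ∑ j, k j * a j ^ 2 ≤ k i * ∑ j, a j ^ 2 := by
    rw [Finset.mul_sum]
    refine Finset.sum_le_sum fun j _ => ?_
    rcases le_or_gt j i with hj | hj
    · exact mul_le_mul_of_nonneg_right (hk hj) (sq_nonneg _)
    · have := hfa j hj.ne'
      rw [if_neg hj.not_gt] at this
      simp [this]
  have hpos : 0 < ∑ j, a j ^ 2 := by
    obtain ⟨j, hj⟩ := Function.ne_iff.1 ha0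
    exact Finset.sum_pos' (fun j _ => sq_nonneg _) ⟨j, Finset.mem_univ _, by
      have : a j ≠ 0 := hj
      positivity⟩
  rw [hT] at h1
  exact le_of_mul_le_mul_right (h1.trans ((h a).trans h2)) hpos

/-- A curvature function is monotone on the positive cone. -/
lemma IsCurvatureFunction.mono {n : ℕ} {γ : (Fin n → ℝ) → ℝ} {α : ℝ}
    (hγ : IsCurvatureFunction γ α) {k l : Fin n → ℝ} (hl : l ∈ positiveCone n)
    (hlk : ∀ i, l i ≤ k i) : γ l ≤ γ k := by
  have hopen : IsOpen (positiveCone n) := by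
    have : positiveCone n = ⋂ i, {k : Fin n → ℝ | 0 < k i} := by ext; simp [positiveCone]
    rw [this]
    exact isOpen_iInter_of_finite fun i => isOpen_lt continuous_const (continuous_apply i)
  have hmem : ∀ t ∈ Icc (0 : ℝ) 1, l + t • (k - l) ∈ positiveCone n := by
    intro t ht i
    have h1 := hl i
    have h2 := mul_nonneg ht.1 (sub_nonneg.2 (hlk i))
    simp only [Pi.add_apply, Pi.smul_apply, Pi.sub_apply, smul_eq_mul]
    linarith
  have hd : ∀ t ∈ Icc (0 : ℝ) 1, HasDerivAt (fun t : ℝ => γ (l + t • (k - l)))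
      (fderiv ℝ γ (l + t • (k - l)) (k - l)) t := by
    intro t ht
    have h1 : DifferentiableAt ℝ γ (l + t • (k - l)) :=
      (hγ.smooth.contDiffAt (hopen.mem_nhds (hmem t ht))).differentiableAt (by simp)
    have h2 : HasDerivAt (fun t : ℝ => l + t • (k - l)) (k - l) t := by
      simpa using ((hasDerivAt_id t).smul_const (k - l)).const_add l
    exact h1.hasFDerivAt.comp_hasDerivAt t h2
  have hm : MonotoneOn (fun t : ℝ => γ (l + t • (k - l))) (Icc 0 1) := by
    apply monotoneOn_of_deriv_nonneg (convex_Icc 0 1)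
    · exact fun t ht => (hd t ht).continuousAt.continuousWithinAt
    · exact fun t ht => (hd t (interior_subset ht)).differentiableAt.differentiableWithinAt
    · intro t ht
      rw [(hd t (interior_subset ht)).deriv]
      have h3 := fun i => (hγ.increasing _ (hmem t (interior_subset ht)) i).le
      generalize fderiv ℝ γ (l + t • (k - l)) = D at h3
      rw [pi_eq_sum_univ' (k - l), map_sum]
      refine Finset.sum_nonneg fun i _ => ?_
      rw [map_smul, smul_eq_mul]
      exact mul_nonneg (sub_nonneg.2 (hlk i)) (h3 i)
  simpa using hm (left_mem_Icc.2 zero_le_one) (right_mem_Icc.2 zero_le_one) zero_le_one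

/-! ### Fundamental forms of a graph and the pointwise equation. -/

/-- The linear map `(x, t) ↦ (x, t)` onto the ambient space. -/
noncomputable def ambientLinear (n : ℕ) : (BaseSpace n × ℝ) →L[ℝ] AmbientSpace n :=
  LinearMap.toContinuousLinearMap
    { toFun := fun q => ambientPoint q.1 q.2
      map_add' := fun p q => by
        ext i
        refine Fin.lastCases ?_ (fun j => ?_) i <;> simp [ambientPoint]
      map_smul' := fun c q => by
        ext i
        refine Fin.lastCases ?_ (fun j => ?_) i <;> simp [ambientPoint] }

/-- The horizontal part of a vector of the ambient space. -/
def horizontalPart {n : ℕ} (p : AmbientSpace n) : BaseSpace n :=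
  WithLp.toLp 2 fun i => p i.castSucc

lemma inner_ambientPoint {n : ℕ} (x : BaseSpace n) (t : ℝ) (p : AmbientSpace n) :
    inner ℝ (ambientPoint x t) p = inner ℝ x (horizontalPart p) + t * p (Fin.last n) := by
  simp [PiLp.inner_apply, Fin.sum_univ_castSucc, ambientPoint, horizontalPart, mul_comm]

lemma horizontalPart_ambientPoint {n : ℕ} (x : BaseSpace n) (t : ℝ) :
    horizontalPart (ambientPoint x t) = x := by
  ext i
  simp [horizontalPart, ambientPoint]

lemma ambientPoint_last {n : ℕ} (x : BaseSpace n) (t : ℝ) :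
    ambientPoint x t (Fin.last n) = t := by
  simp [ambientPoint]

lemma norm_sq_eq_horizontalPart {n : ℕ} (p : AmbientSpace n) :
    ‖p‖ ^ 2 = ‖horizontalPart p‖ ^ 2 + p (Fin.last n) ^ 2 := by
  simp [EuclideanSpace.real_norm_sq_eq, Fin.sum_univ_castSucc, horizontalPart]

lemma inner_verticalVec {n : ℕ} (p : AmbientSpace n) :
    inner ℝ p (verticalVec n) = p (Fin.last n) := by
  simp [verticalVec, EuclideanSpace.inner_single_right]

lemma hasFDerivAt_graphMap {n : ℕ} {u : BaseSpace n → ℝ} {x : BaseSpace n}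
    (hu : DifferentiableAt ℝ u x) :
    HasFDerivAt (graphMap u)
      ((ambientLinear n).comp ((ContinuousLinearMap.id ℝ _).prod (fderiv ℝ u x))) x :=
  (ambientLinear n).hasFDerivAt.comp x ((hasFDerivAt_id x).prodMk hu.hasFDerivAt)

lemma fderiv_graphMap_apply {n : ℕ} {u : BaseSpace n → ℝ} {x : BaseSpace n}
    (hu : DifferentiableAt ℝ u x) (v : BaseSpace n) :
    fderiv ℝ (graphMap u) x v = ambientPoint v (fderiv ℝ u x v) := by
  rw [(hasFDerivAt_graphMap hu).fderiv]
  rfl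

lemma coordDeriv_coordDeriv_graphMap {n : ℕ} {u : BaseSpace n → ℝ} {x : BaseSpace n}
    (hu : ContDiffAt ℝ 2 u x) (i j : Fin n) :
    coordDeriv (coordDeriv (graphMap u) j) i x =
      ambientPoint 0 (fderiv ℝ (fderiv ℝ u) x (EuclideanSpace.single i 1)
        (EuclideanSpace.single j 1)) := by
  have h1 : coordDeriv (graphMap u) j =ᶠ[𝓝 x] fun y => ambientLinear n
      (EuclideanSpace.single j 1, fderiv ℝ u y (EuclideanSpace.single j 1)) := by
    filter_upwards [hu.eventually (by simp)] with y hy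
    exact fderiv_graphMap_apply (hy.differentiableAt (by simp)) _
  have h2 : DifferentiableAt ℝ (fderiv ℝ u) x :=
    (hu.fderiv_right (m := 1) (by norm_num)).differentiableAt (by simp)
  have h3 : HasFDerivAt (fun y => fderiv ℝ u y (EuclideanSpace.single j 1))
      ((fderiv ℝ (fderiv ℝ u) x).flip (EuclideanSpace.single j 1)) x := by
    have := h2.hasFDerivAt.clm_apply (hasFDerivAt_const (EuclideanSpace.single j (1 : ℝ)) x)
    simpa using this
  have h4 := (ambientLinear n).hasFDerivAt.comp x
    ((hasFDerivAt_const (EuclideanSpace.single j (1 : ℝ)) x).prodMk h3)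
  unfold coordDeriv at h1 ⊢
  rw [h1.fderiv_eq]
  erw [h4.fderiv]
  rfl

lemma dotProduct_mulVec_eq_bilin {n : ℕ} {V : Type*} [AddCommGroup V] [Module ℝ V]
    (B : V →ₗ[ℝ] V →ₗ[ℝ] ℝ) (D : BaseSpace n →ₗ[ℝ] V) (a : Fin n → ℝ) :
    a ⬝ᵥ (Matrix.of fun i j => B (D (EuclideanSpace.single i 1))
      (D (EuclideanSpace.single j 1))).mulVec a
      = B (D (WithLp.toLp 2 a)) (D (WithLp.toLp 2 a)) := by
  have h : WithLp.toLp 2 a = ∑ i, a i • EuclideanSpace.single i (1 : ℝ) := by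
    ext j
    simp [Pi.single_apply]
  rw [h]
  simp only [map_sum, map_smul, LinearMap.sum_apply, LinearMap.smul_apply, smul_eq_mul,
    dotProduct, Matrix.mulVec, Matrix.of_apply, Finset.mul_sum]
  rw [Finset.sum_comm]
  exact Finset.sum_congr rfl fun i _ => Finset.sum_congr rfl fun j _ => by ring

/-- The pointwise content of the translator equation for the graph of `u` at `x`: a frame `W`,
orthonormal for the induced metric, which diagonalizes the second fundamental form, with ordered
positive principal curvatures `k` such that `γ k` is the vertical component of the unit normal. -/
def IsTranslatorAt {n : ℕ} (γ : (Fin n → ℝ) → ℝ) (u : BaseSpace n → ℝ) (x : BaseSpace n) : Prop :=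
  ContDiffAt ℝ 2 u x ∧ ∃ N : ℝ, 0 < N ∧ N ^ 2 * (1 + ‖fderiv ℝ u x‖ ^ 2) = 1 ∧
    ∃ k : Fin n → ℝ, Monotone k ∧ k ∈ positiveCone n ∧ γ k = N ∧
      ∃ W : (Fin n → ℝ) ≃ₗ[ℝ] BaseSpace n,
        (∀ a, ‖W a‖ ^ 2 + (fderiv ℝ u x (W a)) ^ 2 = ∑ i, a i ^ 2) ∧
        ∀ a, N * fderiv ℝ (fderiv ℝ u) x (W a) (W a) = ∑ i, k i * a i ^ 2

/-- Positivity of `γ` makes the normal point upwards, so it is determined by the gradient. The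
metric is then `|v|² + (Du v)²` and the second fundamental form is `N * D²u`; diagonalizing them
simultaneously gives the frame. -/
lemma isTranslatorAt_of_equation {n : ℕ} {γ : (Fin n → ℝ) → ℝ} {α : ℝ}
    (hγ : IsCurvatureFunction γ α) {u : BaseSpace n → ℝ} {x : BaseSpace n} {ν : AmbientSpace n}
    (hu : ContDiffAt ℝ 2 u x) (hν : IsUnitNormal (graphMap u) x ν) {k : Fin n → ℝ}
    (hk : IsPrincipalCurvatureVector (graphMap u) ν x k) (hpos : k ∈ positiveCone n)
    (heq : γ k = inner ℝ ν (verticalVec n)) : IsTranslatorAt γ u x := by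
  have hd : DifferentiableAt ℝ u x := hu.differentiableAt (by simp)
  rw [inner_verticalVec] at heq
  set N := ν (Fin.last n) with hN
  have hNpos : 0 < N := heq ▸ hγ.pos k hpos
  have hDu : fderiv ℝ u x = innerSL ℝ (-(N⁻¹ • horizontalPart ν)) := by
    ext v
    have h1 := hν.2 v
    rw [fderiv_graphMap_apply hd, inner_ambientPoint, ← hN] at h1
    rw [innerSL_apply_apply, inner_neg_left, real_inner_smul_left, real_inner_comm]
    field_simp
    linarith
  have hnorm : N ^ 2 * (1 + ‖fderiv ℝ u x‖ ^ 2) = 1 := by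
    have h1 := norm_sq_eq_horizontalPart ν
    rw [hν.1, ← hN] at h1
    rw [hDu, innerSL_apply_norm, norm_neg, norm_smul, Real.norm_of_nonneg (inv_pos.2 hNpos).le]
    field_simp
    linarith
  have hdF : ∀ v, ‖fderiv ℝ (graphMap u) x v‖ ^ 2 = ‖v‖ ^ 2 + (fderiv ℝ u x v) ^ 2 := by
    intro v
    rw [fderiv_graphMap_apply hd, norm_sq_eq_horizontalPart, horizontalPart_ambientPoint,
      ambientPoint_last]
  have hGq : ∀ a : Fin n → ℝ, a ⬝ᵥ (metricMatrix (graphMap u) x).mulVec a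
      = ‖WithLp.toLp 2 a‖ ^ 2 + (fderiv ℝ u x (WithLp.toLp 2 a)) ^ 2 := by
    intro a
    rw [← hdF, ← real_inner_self_eq_norm_sq]
    exact dotProduct_mulVec_eq_bilin (innerₗ _) (fderiv ℝ (graphMap u) x).toLinearMap a
  have hhij : secondFormMatrix (graphMap u) ν x = Matrix.of fun i j =>
      N * fderiv ℝ (fderiv ℝ u) x (EuclideanSpace.single i 1) (EuclideanSpace.single j 1) := by
    ext i j
    simp only [secondFormMatrix, Matrix.of_apply]
    rw [coordDeriv_coordDeriv_graphMap hu, inner_ambientPoint, inner_zero_left, zero_add, mul_comm]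
  have hHq : ∀ a : Fin n → ℝ, a ⬝ᵥ (secondFormMatrix (graphMap u) ν x).mulVec a
      = N * fderiv ℝ (fderiv ℝ u) x (WithLp.toLp 2 a) (WithLp.toLp 2 a) := by
    intro a
    rw [hhij]
    exact dotProduct_mulVec_eq_bilin
      (N • ((ContinuousLinearMap.coeLM ℝ).comp (fderiv ℝ (fderiv ℝ u) x).toLinearMap))
      LinearMap.id a
  have hG : (metricMatrix (graphMap u) x).PosDef := by
    refine Matrix.PosDef.of_dotProduct_mulVec_pos ?_ ?_
    · ext i j
      simp [metricMatrix, real_inner_comm]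
    · intro a ha
      rw [star_trivial, hGq]
      have : WithLp.toLp 2 a ≠ 0 := by simpa using ha
      positivity
  have hH : (secondFormMatrix (graphMap u) ν x).IsHermitian := by
    ext i j
    rw [hhij]
    simp [(hu.isSymmSndFDerivAt (by simp)).eq (EuclideanSpace.single i 1)]
  obtain ⟨σ, hσ, W, hW1, hW2⟩ := exists_simultaneous_diagonalization hG hH hk
  have hdet : IsUnit W.det := by
    have h1 := congrArg Matrix.det hW1
    rw [Matrix.det_mul, Matrix.det_one] at h1
    exact IsUnit.of_mul_eq_one _ ((mul_comm _ _).trans h1)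
  have hconj : ∀ (M : Matrix (Fin n) (Fin n) ℝ) (a : Fin n → ℝ),
      W.mulVec a ⬝ᵥ M.mulVec (W.mulVec a) = a ⬝ᵥ (W.transpose * M * W).mulVec a := by
    intro M a
    rw [← Matrix.mulVec_mulVec, ← Matrix.mulVec_mulVec, Matrix.dotProduct_mulVec a,
      Matrix.vecMul_transpose]
  refine ⟨hu, N, hNpos, hnorm, k ∘ σ, hσ, fun i => hpos _, (hγ.symm k hpos σ).trans heq,
    (Matrix.toLinearEquiv' W ((Matrix.isUnit_iff_isUnit_det W).2 hdet).invertible).trans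
      (WithLp.linearEquiv 2 ℝ (Fin n → ℝ)).symm, fun a => ?_, fun a => ?_⟩
  · have h1 := hGq (W.mulVec a)
    rw [hconj, hW1, Matrix.one_mulVec] at h1
    refine Eq.trans h1.symm ?_
    simp [dotProduct, sq]
  · have h1 := hHq (W.mulVec a)
    rw [hconj, hW2] at h1
    refine Eq.trans h1.symm ?_
    simp only [dotProduct, Matrix.mulVec_diagonal, Function.comp_apply]
    exact Finset.sum_congr rfl fun i _ => by ring

/-! ### Touching and comparison. -/

/-- Touching principle: the second derivative of a translator cannot dominate that of another one
with the same gradient by a factor larger than one. -/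
lemma IsTranslatorAt.le_one_of_hessian_le {n : ℕ} {γ : (Fin n → ℝ) → ℝ} {α : ℝ} (hα : 0 < α)
    (hγ : IsCurvatureFunction γ α) {u v : BaseSpace n → ℝ} {x y : BaseSpace n}
    (hu : IsTranslatorAt γ u x) (hv : IsTranslatorAt γ v y)
    (Q : BaseSpace n ≃ₗᵢ[ℝ] BaseSpace n) (hgrad : ∀ z, fderiv ℝ u x z = fderiv ℝ v y (Q z))
    {c : ℝ} (hc : 0 < c) (hess : ∀ z, c * fderiv ℝ (fderiv ℝ v) y (Q z) (Q z)
      ≤ fderiv ℝ (fderiv ℝ u) x z z) : c ≤ 1 := by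
  obtain ⟨-, N, hN, hNn, k, hk, hkp, hkN, W, hW1, hW2⟩ := hu
  obtain ⟨-, M, hM, hMn, l, hl, hlp, hlM, Z, hZ1, hZ2⟩ := hv
  have hnorm : ‖fderiv ℝ u x‖ = ‖fderiv ℝ v y‖ := by
    have : fderiv ℝ u x = (fderiv ℝ v y).comp (Q : BaseSpace n →L[ℝ] BaseSpace n) := by
      ext z; exact hgrad z
    rw [this]
    exact ContinuousLinearMap.opNorm_comp_linearIsometryEquiv _ Q
  have hNM : N = M := by
    rw [hnorm] at hNn
    have h1 : N ^ 2 = M ^ 2 := mul_right_cancel₀ (b := 1 + ‖fderiv ℝ v y‖ ^ 2)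
      (by positivity) (hNn.trans hMn.symm)
    exact (sq_eq_sq₀ hN.le hM.le).1 h1
  -- Change between the two orthonormal frames. It is an isometry because the induced metric depends
  -- only on the gradient, which `Q` matches.
  let T : (Fin n → ℝ) →ₗ[ℝ] (Fin n → ℝ) :=
    Z.symm.toLinearMap.comp (Q.toLinearEquiv.toLinearMap.comp W.toLinearMap)
  have hZT : ∀ a, Z (T a) = Q (W a) := fun a => by simp [T]
  have hle : ∀ i, (c • l) i ≤ k i := by
    refine fun i => le_of_diagonal_form_le hk
      (fun i j hij => mul_le_mul_of_nonneg_left (hl hij) hc.le) T (fun a => ?_) (fun a => ?_) i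
    · rw [← hZ1, ← hW1, hZT, Q.norm_map, hgrad]
    · have h1 := mul_le_mul_of_nonneg_left (hess (W a)) hN.le
      rw [hW2, ← hZT, mul_left_comm, hNM, hZ2, Finset.mul_sum] at h1
      simpa [mul_assoc] using h1
  have h1 : γ (c • l) ≤ γ k := hγ.mono (fun i => mul_pos hc (hlp i)) hle
  rw [hγ.homogeneous l hlp c hc, hlM, hkN, hNM] at h1
  have h2 : c ^ α ≤ 1 := le_of_mul_le_mul_right (by simpa using h1) hM
  by_contra hcon
  exact absurd h2 (not_le.2 (Real.one_lt_rpow (not_le.1 hcon) hα))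

lemma hasDerivAt_comp_line {n : ℕ} {f : BaseSpace n → ℝ} {x : BaseSpace n} {t : ℝ}
    {z : BaseSpace n} (hf : ContDiffAt ℝ 2 f (x + t • z)) :
    HasDerivAt (fun t : ℝ => f (x + t • z)) (fderiv ℝ f (x + t • z) z) t := by
  have h2 : HasDerivAt (fun t : ℝ => x + t • z) z t := by
    simpa using ((hasDerivAt_id t).smul_const z).const_add x
  exact (hf.differentiableAt (by simp)).hasFDerivAt.comp_hasDerivAt t h2

lemma eventually_hasDerivAt_comp_line {n : ℕ} {f : BaseSpace n → ℝ} {x : BaseSpace n}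
    (hf : ContDiffAt ℝ 2 f x) (z : BaseSpace n) :
    ∀ᶠ t in 𝓝 (0 : ℝ), HasDerivAt (fun t : ℝ => f (x + t • z)) (fderiv ℝ f (x + t • z) z) t := by
  have hc : Tendsto (fun t : ℝ => x + t • z) (𝓝 0) (𝓝 x) := by
    have : Continuous fun t : ℝ => x + t • z := by fun_prop
    simpa using this.tendsto 0
  filter_upwards [hc.eventually (hf.eventually (by simp))] with t ht using hasDerivAt_comp_line ht

lemma hasDerivAt_fderiv_comp_line {n : ℕ} {f : BaseSpace n → ℝ} {x : BaseSpace n} {t : ℝ}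
    {z : BaseSpace n} (hf : ContDiffAt ℝ 2 f (x + t • z)) :
    HasDerivAt (fun t : ℝ => fderiv ℝ f (x + t • z) z)
      (fderiv ℝ (fderiv ℝ f) (x + t • z) z z) t := by
  have h2 : HasDerivAt (fun t : ℝ => x + t • z) z t := by
    simpa using ((hasDerivAt_id t).smul_const z).const_add x
  have h3 : DifferentiableAt ℝ (fderiv ℝ f) (x + t • z) :=
    (hf.fderiv_right (m := 1) (by norm_num)).differentiableAt (by simp)
  exact ((ContinuousLinearMap.apply ℝ ℝ z).hasFDerivAt.comp _ h3.hasFDerivAt).comp_hasDerivAt t h2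

/-- Second-order necessary condition for a local minimum. -/
lemma IsLocalMin.deriv_eq_zero_and_nonneg {g g' : ℝ → ℝ} {a m : ℝ} (hg : IsLocalMin g a)
    (h1 : ∀ᶠ t in 𝓝 a, HasDerivAt g (g' t) t) (h2 : HasDerivAt g' m a) :
    g' a = 0 ∧ 0 ≤ m := by
  have h0 : g' a = 0 := hg.hasDerivAt_eq_zero h1.self_of_nhds
  refine ⟨h0, ?_⟩
  -- If `m < 0`, the second derivative test makes `a` a local maximum as well. Then `g` is locally
  -- constant and `m = 0`.
  by_contra hm
  have hd : deriv g =ᶠ[𝓝 a] g' := h1.mono fun t ht => ht.deriv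
  have hmax : IsLocalMax g a := by
    apply isLocalMax_of_deriv_deriv_neg
    · rw [hd.deriv_eq, h2.deriv]
      exact not_le.1 hm
    · rw [hd.self_of_nhds, h0]
    · exact h1.self_of_nhds.continuousAt
  have hconst : g =ᶠ[𝓝 a] fun _ => g a := by
    filter_upwards [hg, hmax] with t ht1 ht2 using le_antisymm ht2 ht1
  have hzero : g' =ᶠ[𝓝 a] fun _ => 0 := by
    filter_upwards [hd, hconst.eventuallyEq_nhds] with t ht1 ht2
    rw [← ht1, ht2.deriv_eq, deriv_const]
  have : m = 0 := h2.unique ((hasDerivAt_const a (0 : ℝ)).congr_of_eventuallyEq hzero)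
  exact hm this.ge

/-- Shrinking a translator by the factor `s < 1` yields a strict subsolution, which cannot touch
another translator from below. -/
lemma not_isLocalMin_sub_dilation {n : ℕ} {γ : (Fin n → ℝ) → ℝ} {α : ℝ} (hα : 0 < α)
    (hγ : IsCurvatureFunction γ α) {f₁ f₂ : BaseSpace n → ℝ}
    (Q : BaseSpace n ≃ₗᵢ[ℝ] BaseSpace n) (b : BaseSpace n) {s : ℝ} (hs : 0 < s) (hs1 : s < 1)
    {y : BaseSpace n} (h₁ : IsTranslatorAt γ f₁ y)
    (h₂ : IsTranslatorAt γ f₂ (s⁻¹ • (Q y + b))) :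
    ¬ IsLocalMin (fun y => f₁ y - s * f₂ (s⁻¹ • (Q y + b))) y := by
  intro hmin
  -- First and second order conditions along each line through `y`. The dilation leaves the gradient
  -- alone and multiplies the Hessian by `s⁻¹ > 1`, against the touching principle.
  have key : ∀ z, fderiv ℝ f₁ y z = fderiv ℝ f₂ (s⁻¹ • (Q y + b)) (Q z) ∧
      s⁻¹ * fderiv ℝ (fderiv ℝ f₂) (s⁻¹ • (Q y + b)) (Q z) (Q z)
        ≤ fderiv ℝ (fderiv ℝ f₁) y z z := by
    intro z
    set w := s⁻¹ • (Q y + b) with hw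
    have hline : ∀ t : ℝ, s⁻¹ • (Q (y + t • z) + b) = w + t • (s⁻¹ • Q z) := by
      intro t
      rw [hw, map_add, map_smul]
      module
    have hg : IsLocalMin (fun t : ℝ => f₁ (y + t • z) - s * f₂ (w + t • (s⁻¹ • Q z))) 0 := by
      have hc : Tendsto (fun t : ℝ => y + t • z) (𝓝 0) (𝓝 y) := by
        have : Continuous fun t : ℝ => y + t • z := by fun_prop
        simpa using this.tendsto 0
      have := hc.eventually hmin
      filter_upwards [this] with t ht
      have ht' : f₁ y - s * f₂ w ≤ f₁ (y + t • z) - s * f₂ (s⁻¹ • (Q (y + t • z) + b)) := ht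
      rw [hline] at ht'
      simpa only [zero_smul, add_zero] using ht'
    have hd := (eventually_hasDerivAt_comp_line h₁.1 z).and
      (eventually_hasDerivAt_comp_line h₂.1 (s⁻¹ • Q z))
    have hdd1 := hasDerivAt_fderiv_comp_line (x := y) (t := 0) (z := z) (by simpa using h₁.1)
    have hdd2 := hasDerivAt_fderiv_comp_line (x := w) (t := 0) (z := s⁻¹ • Q z)
      (by simpa using h₂.1)
    have h := hg.deriv_eq_zero_and_nonneg (hd.mono fun t ht => ht.1.sub (ht.2.const_mul s))
      (hdd1.sub (hdd2.const_mul s))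
    simp only [zero_smul, add_zero, map_smul, smul_eq_mul, smul_apply] at h
    obtain ⟨h3, h4⟩ := h
    constructor
    · field_simp at h3
      linarith
    · field_simp at h4 ⊢
      linarith
  have := h₁.le_one_of_hessian_le hα hγ h₂ Q (fun z => (key z).1) (inv_pos.2 hs)
    fun z => (key z).2
  exact absurd this (not_le.2 ((one_lt_inv₀ hs).2 hs1))

/-- Comparison principle: the infimum of the difference of two translators, one of which is
precomposed with a rigid motion of the base, is attained at the boundary. -/
lemma le_sub_of_le_sub_boundary {n : ℕ} {γ : (Fin n → ℝ) → ℝ} {α : ℝ} (hα : 0 < α)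
    (hγ : IsCurvatureFunction γ α) {f₁ f₂ : BaseSpace n → ℝ} {r₁ r₂ : ℝ}
    (h₁ : ∀ x ∈ ball 0 r₁, IsTranslatorAt γ f₁ x) (h₂ : ∀ x ∈ ball 0 r₂, IsTranslatorAt γ f₂ x)
    (Q : BaseSpace n ≃ₗᵢ[ℝ] BaseSpace n) (b : BaseSpace n) {K : Set (BaseSpace n)}
    (hK : IsCompact K) (hK₁ : K ⊆ ball 0 r₁) (hK₂ : ∀ y ∈ K, Q y + b ∈ ball 0 r₂) {m : ℝ}
    (hm : ∀ y ∈ K \ interior K, m ≤ f₁ y - f₂ (Q y + b)) {x : BaseSpace n} (hx : x ∈ K) :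
    m ≤ f₁ x - f₂ (Q x + b) := by
  by_contra hlt
  rw [not_le] at hlt
  have hB : ∀ y, ContinuousAt (fun p : ℝ × BaseSpace n => p.1⁻¹ • (Q p.2 + b)) (1, y) := by
    intro y
    refine ContinuousAt.smul (ContinuousAt.inv₀ continuousAt_fst (by simp)) ?_
    have : Continuous fun p : ℝ × BaseSpace n => Q p.2 + b := by fun_prop
    exact this.continuousAt
  have hψ : ∀ y ∈ K, ContinuousAt
      (fun p : ℝ × BaseSpace n => f₁ p.2 - p.1 * f₂ (p.1⁻¹ • (Q p.2 + b))) (1, y) := by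
    intro y hy
    have e1 : ContinuousAt (fun p : ℝ × BaseSpace n => f₁ p.2) (1, y) :=
      ContinuousAt.comp (f := Prod.snd) (h₁ y (hK₁ hy)).1.continuousAt continuousAt_snd
    have e2 : ContinuousAt (fun p : ℝ × BaseSpace n => f₂ (p.1⁻¹ • (Q p.2 + b))) (1, y) :=
      ContinuousAt.comp (g := f₂) (by simpa using (h₂ _ (hK₂ y hy)).1.continuousAt) (hB y)
    exact e1.sub (continuousAt_fst.mul e2)
  have ev1 : ∀ᶠ s in 𝓝 (1 : ℝ), ∀ y ∈ K, s⁻¹ • (Q y + b) ∈ ball (0 : BaseSpace n) r₂ := by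
    apply hK.eventually_forall_of_forall_eventually
    intro y hy
    exact (hB y).eventually (isOpen_ball.mem_nhds (by simpa using hK₂ y hy))
  -- At `s = 1` the value at `x` is below `m`, hence strictly below every boundary value. By
  -- compactness this gap persists for `s` near `1`, so for some `s < 1` the minimum over `K` is
  -- interior.
  have ev2 : ∀ᶠ s in 𝓝 (1 : ℝ), ∀ y ∈ K \ interior K,
      f₁ x - s * f₂ (s⁻¹ • (Q x + b)) < f₁ y - s * f₂ (s⁻¹ • (Q y + b)) := by
    apply (hK.diff isOpen_interior).eventually_forall_of_forall_eventually
    intro y hy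
    have e1 := hψ y hy.1
    have e2 : ContinuousAt (fun p : ℝ × BaseSpace n => f₁ x - p.1 * f₂ (p.1⁻¹ • (Q x + b)))
        (1, y) := by
      have : ContinuousAt (fun p : ℝ × BaseSpace n => ((p.1, x) : ℝ × BaseSpace n)) (1, y) :=
        continuousAt_fst.prodMk continuousAt_const
      exact ContinuousAt.comp
        (g := fun p : ℝ × BaseSpace n => f₁ p.2 - p.1 * f₂ (p.1⁻¹ • (Q p.2 + b)))
        (f := fun p : ℝ × BaseSpace n => ((p.1, x) : ℝ × BaseSpace n)) (x := (1, y))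
        (hψ x hx) this
    refine e2.eventually_lt e1 ?_
    have := hm y hy
    simp only [inv_one, one_smul, one_mul]
    linarith
  obtain ⟨s, ⟨⟨hs2, hs3⟩, hs0⟩, hs1⟩ := ((((ev1.and ev2).and
    (lt_mem_nhds (zero_lt_one (α := ℝ)))).filter_mono nhdsWithin_le_nhds).and
      (self_mem_nhdsWithin : Iio (1 : ℝ) ∈ 𝓝[<] 1)).exists
  have hcont : ContinuousOn (fun y => f₁ y - s * f₂ (s⁻¹ • (Q y + b))) K := by
    intro y hy
    refine ContinuousAt.continuousWithinAt ?_
    refine (h₁ y (hK₁ hy)).1.continuousAt.sub (continuousAt_const.mul ?_)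
    refine ContinuousAt.comp (g := f₂) (h₂ _ (hs2 y hy)).1.continuousAt ?_
    have : Continuous fun y : BaseSpace n => s⁻¹ • (Q y + b) := by fun_prop
    exact this.continuousAt
  obtain ⟨y, hyK, hy⟩ := hK.exists_isMinOn ⟨x, hx⟩ hcont
  have hyint : y ∈ interior K := by
    by_contra hcon
    exact absurd (hy hx) (not_le.2 (hs3 y ⟨hyK, hcon⟩))
  exact not_isLocalMin_sub_dilation hα hγ Q b hs0 hs1 (h₁ y (hK₁ hyK)) (h₂ _ (hs2 y hyK))
    (hy.isLocalMin (mem_interior_iff_mem_nhds.1 hyint))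

/-! ### Convexity and blow-up at the boundary sphere. -/

lemma IsTranslatorAt.hessian_nonneg {n : ℕ} {γ : (Fin n → ℝ) → ℝ} {u : BaseSpace n → ℝ}
    {x : BaseSpace n} (h : IsTranslatorAt γ u x) (z : BaseSpace n) :
    0 ≤ fderiv ℝ (fderiv ℝ u) x z z := by
  obtain ⟨-, N, hN, -, k, -, hk, -, W, -, hW⟩ := h
  have h1 := hW (W.symm z)
  rw [W.apply_symm_apply] at h1
  refine nonneg_of_mul_nonneg_right (h1 ▸ ?_) hN
  exact Finset.sum_nonneg fun i _ => mul_nonneg (hk i).le (sq_nonneg _)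

lemma convexOn_of_isTranslatorAt {n : ℕ} {γ : (Fin n → ℝ) → ℝ} {u : BaseSpace n → ℝ} {r : ℝ}
    (h : ∀ x ∈ ball 0 r, IsTranslatorAt γ u x) : ConvexOn ℝ (ball 0 r) u := by
  refine ⟨convex_ball 0 r, fun x hx y hy a b ha hb hab => ?_⟩
  have hmem : ∀ t ∈ Icc (0 : ℝ) 1, x + t • (y - x) ∈ ball 0 r := fun t ht =>
    (convex_ball (0 : BaseSpace n) r).add_smul_sub_mem hx hy ht
  have hg : ConvexOn ℝ (Icc 0 1) fun t : ℝ => u (x + t • (y - x)) := by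
    refine convexOn_of_hasDerivWithinAt2_nonneg (convex_Icc 0 1)
      (f' := fun t => fderiv ℝ u (x + t • (y - x)) (y - x))
      (f'' := fun t => fderiv ℝ (fderiv ℝ u) (x + t • (y - x)) (y - x) (y - x)) ?_ ?_ ?_ ?_
    · exact fun t ht =>
        (hasDerivAt_comp_line (h _ (hmem t ht)).1).continuousAt.continuousWithinAt
    · exact fun t ht =>
        (hasDerivAt_comp_line (h _ (hmem t (interior_subset ht))).1).hasDerivWithinAt
    · exact fun t ht =>
        (hasDerivAt_fderiv_comp_line (h _ (hmem t (interior_subset ht))).1).hasDerivWithinAt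
    · exact fun t ht => (h _ (hmem t (interior_subset ht))).hessian_nonneg _
  have h1 := hg.2 (left_mem_Icc.2 zero_le_one) (right_mem_Icc.2 zero_le_one) ha hb hab
  have h2 : a • x + b • y = x + b • (y - x) := by
    rw [← sub_eq_iff_eq_add.2 hab.symm]
    module
  rw [h2]
  simpa using h1

lemma norm_ambientPoint_le {n : ℕ} (x : BaseSpace n) (t : ℝ) :
    ‖ambientPoint x t‖ ≤ ‖x‖ + |t| := by
  refine le_of_sq_le_sq ?_ (by positivity)
  rw [norm_sq_eq_horizontalPart, horizontalPart_ambientPoint, ambientPoint_last, add_sq, sq_abs]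
  have : 0 ≤ ‖x‖ * |t| := by positivity
  linarith

/-- Along a ray, a convex function whose graph is complete is unbounded above. -/
lemma exists_lt_on_ray {n : ℕ} {u : BaseSpace n → ℝ} {r : ℝ} (hr : 0 < r)
    (hconv : ConvexOn ℝ (ball 0 r) u) (hcont : ContinuousOn u (ball 0 r))
    (hcomp : IsLengthComplete (graphOverBall r u)) {q : BaseSpace n} (hq : ‖q‖ = r) (C : ℝ) :
    ∃ t ∈ Ico (0 : ℝ) 1, C < u (t • q) := by
  by_contra! hC
  have hmem : ∀ t ∈ Ioo (-1 : ℝ) 1, t • q ∈ ball (0 : BaseSpace n) r := by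
    intro t ht
    rw [mem_ball_zero_iff, norm_smul, hq, Real.norm_eq_abs]
    exact (mul_lt_iff_lt_one_left hr).2 (abs_lt.2 ht)
  have hIco : Ico (0 : ℝ) 1 ⊆ Ioo (-1) 1 := fun t ht => ⟨by linarith [ht.1], ht.2⟩
  set g : ℝ → ℝ := fun t => u (t • q) with hg
  have hgc : ConvexOn ℝ (Ioo (-1) 1) g := by
    refine ⟨convex_Ioo _ _, fun x hx y hy a b ha hb hab => ?_⟩
    have := hconv.2 (hmem x hx) (hmem y hy) ha hb hab
    simpa only [hg, add_smul, smul_assoc] using this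
  -- By convexity the slope on `[-1/2, 0]` is a lower bound for all slopes on `[0, 1)`.
  set L := (g 0 - g (-1 / 2)) / (0 - -1 / 2) with hL
  have hslope : ∀ a ∈ Ico (0 : ℝ) 1, ∀ b ∈ Ico (0 : ℝ) 1, a ≤ b → L * (b - a) ≤ g b - g a := by
    intro a ha b hb hab
    rcases hab.eq_or_lt with rfl | hab
    · simp
    have h0 : ∀ c ∈ Ico (0 : ℝ) 1, 0 < c → L ≤ (g c - g 0) / (c - 0) := fun c hc hc0 =>
      hgc.slope_mono_adjacent (by norm_num) (hIco hc) (by norm_num) hc0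
    have : L ≤ (g b - g a) / (b - a) := by
      rcases ha.1.eq_or_lt with rfl | ha0
      · exact h0 b hb hab
      · exact (h0 a ha ha0).trans
          (hgc.slope_mono_adjacent (by norm_num) (hIco hb) ha0 hab)
    exact (le_div_iff₀ (sub_pos.2 hab)).1 this
  -- Since `g t - L * t` is monotone, increments of `H` dominate chord lengths of the graph. They
  -- telescope, and the assumed bound `C` on `g` makes the length finite.
  set H : ℝ → ℝ := fun t => (r + |L| - L) * t + g t with hH
  have hdist : ∀ a ∈ Ico (0 : ℝ) 1, ∀ b ∈ Ico (0 : ℝ) 1, a ≤ b →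
      ‖graphMap u (b • q) - graphMap u (a • q)‖ ≤ H b - H a := by
    intro a ha b hb hab
    have h1 : graphMap u (b • q) - graphMap u (a • q)
        = ambientPoint ((b - a) • q) (g b - g a) := by
      have := (ambientLinear n).map_sub (b • q, g b) (a • q, g a)
      rw [Prod.mk_sub_mk, ← sub_smul] at this
      exact this.symm
    have h2 := hslope a ha b hb hab
    have h3 : |g b - g a| ≤ (g b - g a - L * (b - a)) + |L| * (b - a) := by
      have h4 := abs_add_le (g b - g a - L * (b - a)) (L * (b - a))
      rwa [sub_add_cancel, abs_of_nonneg (sub_nonneg.2 h2), abs_mul,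
        abs_of_nonneg (sub_nonneg.2 hab)] at h4
    rw [h1]
    refine (norm_ambientPoint_le _ _).trans ?_
    rw [norm_smul, hq, Real.norm_of_nonneg (sub_nonneg.2 hab)]
    simp only [hH]
    linarith
  have hzero : (0 : ℝ) ∈ Ico (0 : ℝ) 1 := ⟨le_rfl, zero_lt_one⟩
  have hbound : ∀ a ∈ Ico (0 : ℝ) 1, ∀ b ∈ Ico (0 : ℝ) 1,
      H b - H a ≤ r + |L| + |L| + C - g 0 := by
    intro a ha b hb
    have h1 : 0 ≤ H a - H 0 := (norm_nonneg _).trans (hdist 0 hzero a ha ha.1)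
    have h2 := hC b hb
    have h3 : (r + |L| - L) * b ≤ r + |L| + |L| := by
      have h4 : 0 ≤ r + |L| - L := by linarith [le_abs_self L]
      have h5 := mul_le_mul_of_nonneg_left hb.2.le h4
      linarith [neg_abs_le L]
    simp only [hH, mul_zero, zero_add] at h1 ⊢
    have h6 : g b ≤ C := h2
    linarith
  have hvar : eVariationOn (fun t : ℝ => graphMap u (t • q)) (Ico 0 1) ≠ ⊤ := by
    refine ne_top_of_le_ne_top (ENNReal.ofReal_ne_top (r := r + |L| + |L| + C - g 0)) ?_
    refine iSup_le fun p => ?_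
    obtain ⟨N, v, hv, hvm⟩ := p
    calc ∑ i ∈ Finset.range N, edist (graphMap u (v (i + 1) • q)) (graphMap u (v i • q))
        ≤ ∑ i ∈ Finset.range N, ENNReal.ofReal (H (v (i + 1)) - H (v i)) := by
          refine Finset.sum_le_sum fun i _ => ?_
          rw [edist_dist, dist_eq_norm]
          exact ENNReal.ofReal_le_ofReal (hdist _ (hvm i) _ (hvm (i + 1)) (hv i.le_succ))
      _ = ENNReal.ofReal (∑ i ∈ Finset.range N, (H (v (i + 1)) - H (v i))) :=
          (ENNReal.ofReal_sum_of_nonneg fun i _ => (norm_nonneg _).trans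
            (hdist _ (hvm i) _ (hvm (i + 1)) (hv i.le_succ))).symm
      _ ≤ _ := by
          rw [Finset.sum_range_sub fun i => H (v i)]
          exact ENNReal.ofReal_le_ofReal (hbound _ (hvm 0) _ (hvm N))
  have hcc : ContinuousOn (fun t : ℝ => graphMap u (t • q)) (Ico 0 1) := by
    have h1 : ContinuousOn (fun t : ℝ => t • q) (Ico 0 1) := by fun_prop
    exact (ambientLinear n).continuous.comp_continuousOn
      (h1.prodMk (hcont.comp h1 fun t ht => hmem t (hIco ht)))
  obtain ⟨p, ⟨x, hx, rfl⟩, hp⟩ := hcomp _ hcc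
    (fun t ht => ⟨t • q, hmem t (hIco ht), rfl⟩) hvar
  -- The limit point provided by completeness would lie over `q`, which is outside the open ball.
  have hproj : Continuous fun p : AmbientSpace n => horizontalPart p := by
    unfold horizontalPart
    fun_prop
  have h1 : Tendsto (fun t : ℝ => t • q) (𝓝[<] 1) (𝓝 x) := by
    have := (hproj.tendsto _).comp hp
    simpa only [Function.comp_def, graphMap, horizontalPart_ambientPoint] using this
  have h2 : Tendsto (fun t : ℝ => t • q) (𝓝[<] 1) (𝓝 q) := by
    have : Continuous fun t : ℝ => t • q := by fun_prop
    simpa using (this.tendsto 1).mono_left nhdsWithin_le_nhds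
  rw [tendsto_nhds_unique h1 h2, mem_ball_zero_iff, hq] at hx
  exact lt_irrefl _ hx

/-- A convex function on a ball with complete graph tends to infinity at the boundary. -/
lemma exists_radius_forall_lt {n : ℕ} {u : BaseSpace n → ℝ} {r : ℝ} (hr : 0 < r)
    (hconv : ConvexOn ℝ (ball 0 r) u) (hcont : ContinuousOn u (ball 0 r))
    (hcomp : IsLengthComplete (graphOverBall r u)) (C : ℝ) :
    ∃ ρ < r, ∀ x ∈ ball 0 r, ρ ≤ ‖x‖ → C < u x := by
  have hmem : ∀ t ∈ Ico (0 : ℝ) 1, ∀ q : BaseSpace n, ‖q‖ = r → t • q ∈ ball (0 : _) r := by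
    intro t ht q hq
    rw [mem_ball_zero_iff, norm_smul, hq, Real.norm_of_nonneg ht.1]
    exact (mul_lt_iff_lt_one_left hr).2 ht.2
  have hev : ∀ᶠ t in 𝓝 (1 : ℝ), ∀ q ∈ sphere (0 : BaseSpace n) r,
      t < 1 → ‖q‖ = r → C < u (t • q) := by
    apply (isCompact_sphere (0 : BaseSpace n) r).eventually_forall_of_forall_eventually
    intro q hq
    rw [mem_sphere_zero_iff_norm] at hq
    -- Exceeding `u 0` as well lets convexity on segments from the center carry the bound `C`
    -- outwards, also along nearby rays.
    obtain ⟨t₀, ht₀, hlt⟩ := exists_lt_on_ray hr hconv hcont hcomp hq (max C (u 0))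
    have h1 : ContinuousAt (fun p : ℝ × BaseSpace n => u (t₀ • p.2)) (1, q) := by
      refine ContinuousAt.comp (g := u) (f := fun p : ℝ × BaseSpace n => t₀ • p.2)
        (hcont.continuousAt (isOpen_ball.mem_nhds (hmem t₀ ht₀ q hq))) ?_
      fun_prop
    filter_upwards [h1.eventually (lt_mem_nhds hlt),
      (continuousAt_fst (p := ((1 : ℝ), q))).eventually (lt_mem_nhds ht₀.2)]
      with p hp1 hp2 hp3 hp4
    have hp0 : 0 < p.1 := ht₀.1.trans_lt hp2
    have hseg : t₀ • p.2 ∈ segment ℝ 0 (p.1 • p.2) := by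
      rw [segment_eq_image']
      refine ⟨t₀ / p.1, ⟨div_nonneg ht₀.1 hp0.le, (div_le_one hp0).2 hp2.le⟩, ?_⟩
      simp only [sub_zero, zero_add, smul_smul]
      rw [div_mul_cancel₀ _ hp0.ne']
    have := hconv.le_on_segment (mem_ball_self hr) (hmem p.1 ⟨hp0.le, hp3⟩ p.2 hp4) hseg
    rcases le_max_iff.1 this with h | h
    · exact absurd ((le_max_right _ _).trans_lt hp1) (not_lt.2 h)
    · exact ((le_max_left _ _).trans_lt hp1).trans_le h
  obtain ⟨l, hl, hl'⟩ := exists_Ioc_subset_of_mem_nhds hev ⟨0, zero_lt_one⟩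
  -- A ratio strictly between `l` and `1`; its positivity keeps `x` away from the center, so that
  -- `x` can be rescaled to the sphere.
  set m := (1 + max l 0) / 2 with hm
  have hm0 : 0 < m := by have := le_max_right l 0; rw [hm]; linarith
  have hlm : l < m := by
    have h1 := le_max_left l 0
    have h2 : max l 0 < 1 := max_lt hl zero_lt_one
    rw [hm]
    linarith
  have hm1 : m < 1 := by
    have h2 : max l 0 < 1 := max_lt hl zero_lt_one
    rw [hm]
    linarith
  refine ⟨m * r, (mul_lt_iff_lt_one_left hr).2 hm1, fun x hx hxm => ?_⟩
  rw [mem_ball_zero_iff] at hx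
  have hx0 : 0 < ‖x‖ := (mul_pos hm0 hr).trans_le hxm
  have ht1 : ‖x‖ / r < 1 := (div_lt_one hr).2 hx
  have ht2 : l < ‖x‖ / r := hlm.trans_le ((le_div_iff₀ hr).2 hxm)
  have hq : ‖(r / ‖x‖) • x‖ = r := by
    rw [norm_smul, Real.norm_of_nonneg (by positivity)]
    field_simp
  have := hl' ⟨ht2, ht1.le⟩ _ (mem_sphere_zero_iff_norm.2 hq) ht1 hq
  rw [smul_smul] at this
  have h1 : ‖x‖ / r * (r / ‖x‖) = 1 := by field_simp
  rwa [h1, one_smul] at this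

lemma IsCompleteConvexTranslatorGraph.isTranslatorAt {n : ℕ} {γ : (Fin n → ℝ) → ℝ} {α : ℝ}
    (hγ : IsCurvatureFunction γ α) {r : ℝ} {u : BaseSpace n → ℝ}
    {ν : BaseSpace n → AmbientSpace n} (hu : IsCompleteConvexTranslatorGraph γ r u ν) :
    ∀ x ∈ ball 0 r, IsTranslatorAt γ u x := by
  intro x hx
  obtain ⟨k, hk, hpos, heq⟩ := hu.translator.equation x hx
  exact isTranslatorAt_of_equation hγ
    (contDiffAt_infty.1 (hu.smooth.contDiffAt (isOpen_ball.mem_nhds hx)) 2)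
    (hu.translator.isUnitNormal x hx) hk hpos heq

lemma IsCompleteConvexTranslatorGraph.exists_radius_forall_lt {n : ℕ} {γ : (Fin n → ℝ) → ℝ}
    {α : ℝ} (hγ : IsCurvatureFunction γ α) {r : ℝ} {u : BaseSpace n → ℝ}
    {ν : BaseSpace n → AmbientSpace n} (hu : IsCompleteConvexTranslatorGraph γ r u ν) (C : ℝ) :
    ∃ ρ < r, ∀ x ∈ ball 0 r, ρ ≤ ‖x‖ → C < u x :=
  _root_.exists_radius_forall_lt hu.radius_pos (convexOn_of_isTranslatorAt (hu.isTranslatorAt hγ))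
    hu.smooth.continuousOn hu.complete C

lemma IsTranslatorAt.exists_forall_closedBall_le {n : ℕ} {γ : (Fin n → ℝ) → ℝ} {r ρ : ℝ}
    {u : BaseSpace n → ℝ} (hu : ∀ x ∈ ball 0 r, IsTranslatorAt γ u x) (hρ : ρ < r) :
    ∃ C, ∀ x ∈ closedBall (0 : BaseSpace n) ρ, u x ≤ C := by
  obtain ⟨C, hC⟩ := (isCompact_closedBall (0 : BaseSpace n) ρ).bddAbove_image
    (f := u) fun x hx => (hu x (closedBall_subset_ball hρ hx)).1.continuousAt.continuousWithinAt
  exact ⟨C, fun x hx => hC (mem_image_of_mem u hx)⟩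

lemma norm_eq_of_mem_closedBall_diff_interior {n : ℕ} {ρ : ℝ} {y : BaseSpace n}
    (hy : y ∈ closedBall (0 : BaseSpace n) ρ \ interior (closedBall 0 ρ)) : ‖y‖ = ρ := by
  by_contra hne
  exact hy.2 (ball_subset_interior_closedBall
    (mem_ball_zero_iff.2 (lt_of_le_of_ne (mem_closedBall_zero_iff.1 hy.1) hne)))

/-! ### Alexandrov reflection and rotational symmetry. -/

lemma norm_sub_smul_sq {n : ℕ} {e : BaseSpace n} (he : ‖e‖ = 1) (y : BaseSpace n) (c : ℝ) :
    ‖y - c • e‖ ^ 2 = ‖y‖ ^ 2 - 2 * c * inner ℝ e y + c ^ 2 := by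
  rw [norm_sub_sq_real, real_inner_smul_right, norm_smul, he, real_inner_comm, mul_one,
    Real.norm_eq_abs, sq_abs]
  ring

/-- Reflecting a point of the ball across a hyperplane towards the center does not increase a
complete translator. -/
lemma IsCompleteConvexTranslatorGraph.reflect_le {n : ℕ} {γ : (Fin n → ℝ) → ℝ} {α : ℝ}
    (hα : 0 < α) (hγ : IsCurvatureFunction γ α) {r : ℝ} {u : BaseSpace n → ℝ}
    {ν : BaseSpace n → AmbientSpace n} (hu : IsCompleteConvexTranslatorGraph γ r u ν)
    {e : BaseSpace n} (he : ‖e‖ = 1) {t : ℝ} (ht : 0 < t) {y : BaseSpace n}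
    (hy : y ∈ ball (0 : BaseSpace n) r) (hty : t ≤ inner ℝ e y) :
    u (y - (2 * (inner ℝ e y - t)) • e) ≤ u y := by
  have hT := hu.isTranslatorAt hγ
  have hconv := convexOn_of_isTranslatorAt hT
  let Q : BaseSpace n ≃ₗᵢ[ℝ] BaseSpace n := (ℝ ∙ e)ᗮ.reflection
  have hQ : ∀ z, Q z + (2 * t) • e = z - (2 * (inner ℝ e z - t)) • e := by
    intro z
    have h1 : Q z = -(2 • (inner ℝ e z / (‖e‖ : ℝ) ^ 2) • e - z) := by
      exact (Submodule.reflection_orthogonal_apply (ℝ ∙ e) z).trans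
        (congrArg Neg.neg (Submodule.reflection_singleton_apply e z))
    rw [h1, he]
    module
  have hsq : ∀ z : BaseSpace n, ∀ c : ℝ, 0 ≤ c → c ≤ 2 * inner ℝ e z →
      ‖z - c • e‖ ^ 2 ≤ ‖z‖ ^ 2 := by
    intro z c hc0 hc
    rw [norm_sub_smul_sq he]
    nlinarith
  have hball : ∀ z ∈ ball (0 : BaseSpace n) r, ∀ c : ℝ, 0 ≤ c → c ≤ 2 * inner ℝ e z →
      z - c • e ∈ ball (0 : BaseSpace n) r := by
    intro z hz c hc0 hc
    rw [mem_ball_zero_iff] at hz ⊢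
    exact (le_of_sq_le_sq (hsq z c hc0 hc) (norm_nonneg z)).trans_lt hz
  have hr := hu.radius_pos
  -- Here `t > 0` matters: it yields a fixed compact ball on which `u` is bounded.
  have hσ : √(r ^ 2 - t ^ 2) < r := by
    rw [Real.sqrt_lt' hr]
    have : 0 < t ^ 2 := by positivity
    linarith
  obtain ⟨C, hC⟩ := IsTranslatorAt.exists_forall_closedBall_le hT hσ
  obtain ⟨ρ₀, hρ₀, hρ⟩ := hu.exists_radius_forall_lt hγ C
  set ρ := max ρ₀ ‖y‖
  have hρr : ρ < r := max_lt hρ₀ (mem_ball_zero_iff.1 hy)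
  have hcap : IsClosed {z : BaseSpace n | t ≤ inner ℝ e z} :=
    isClosed_le continuous_const (by fun_prop)
  have hfar : ∀ z ∈ ball (0 : BaseSpace n) r, t ≤ inner ℝ e z → ρ₀ ≤ ‖z‖ →
      u (z - (2 * (inner ℝ e z - t)) • e) ≤ u z := by
    intro z hz htz hz'
    set a := inner ℝ e z with ha
    -- This is the mirror image of `z` at height `t / 2`. Its squared norm is `‖z‖² - 2 * a * t +
    -- t²`, at most `r² - t²` because `a ≥ t`. The image of `z` at height `t` lies between `z` and
    -- this point, so convexity bounds its value by `max (u z) C`, and `u z > C`.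
    have hdeep : z - (2 * a - t) • e ∈ closedBall (0 : BaseSpace n) √(r ^ 2 - t ^ 2) := by
      rw [mem_closedBall_zero_iff]
      refine Real.le_sqrt_of_sq_le ?_
      rw [norm_sub_smul_sq he, ← ha]
      have h1 : ‖z‖ ^ 2 ≤ r ^ 2 :=
        pow_le_pow_left₀ (norm_nonneg z) (mem_ball_zero_iff.1 hz).le 2
      nlinarith
    have hseg : z - (2 * (a - t)) • e ∈ segment ℝ z (z - (2 * a - t) • e) := by
      rw [segment_eq_image']
      have hpos : 0 < 2 * a - t := by linarith
      refine ⟨2 * (a - t) / (2 * a - t), ⟨div_nonneg (by linarith) hpos.le,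
        (div_le_one hpos).2 (by linarith)⟩, ?_⟩
      simp only [sub_sub_cancel_left, smul_neg, smul_smul]
      rw [div_mul_cancel₀ _ hpos.ne', ← sub_eq_add_neg]
    have h2 := hconv.le_on_segment hz (hball z hz _ (by linarith) (by linarith)) hseg
    rcases le_max_iff.1 h2 with h | h
    · exact h
    · exact h.trans ((hC _ hdeep).trans (hρ z hz hz').le)
  have hmain := le_sub_of_le_sub_boundary hα hγ hT hT Q ((2 * t) • e)
    (K := closedBall (0 : BaseSpace n) ρ ∩ {z | t ≤ inner ℝ e z}) (m := 0) (x := y)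
    ((isCompact_closedBall _ _).inter_right hcap)
    (fun z hz => closedBall_subset_ball hρr hz.1) (fun z hz => ?_) (fun z hz => ?_)
    ⟨mem_closedBall_zero_iff.2 (le_max_right _ _), hty⟩
  · rw [hQ] at hmain
    linarith
  · rw [hQ]
    have h1 : t ≤ inner ℝ e z := hz.2
    exact hball z (closedBall_subset_ball hρr hz.1) _ (by linarith) (by linarith)
  -- A boundary point of the truncated cap is on the flat face, where the reflection fixes it, or
  -- has norm at least `ρ₀`, where `hfar` applies.
  · rw [hQ, sub_nonneg]
    have h1 : t ≤ inner ℝ e z := hz.1.2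
    rcases h1.eq_or_lt with h2 | h2
    · rw [← h2]
      simp
    refine hfar z (closedBall_subset_ball hρr hz.1.1) h1 ((le_max_left ρ₀ ‖y‖).trans ?_)
    by_contra hlt
    refine hz.2 (mem_interior.2 ⟨ball 0 ρ ∩ {z | t < inner ℝ e z}, fun w hw =>
      ⟨ball_subset_closedBall hw.1, (show t < inner ℝ e w from hw.2).le⟩, isOpen_ball.inter
        (isOpen_lt continuous_const (by fun_prop)), mem_ball_zero_iff.2 (not_le.1 hlt), h2⟩)

/-- A complete strictly convex translator over a ball is rotationally symmetric. -/
lemma IsCompleteConvexTranslatorGraph.eq_of_norm_eq {n : ℕ} {γ : (Fin n → ℝ) → ℝ} {α : ℝ}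
    (hα : 0 < α) (hγ : IsCurvatureFunction γ α) {r : ℝ} {u : BaseSpace n → ℝ}
    {ν : BaseSpace n → AmbientSpace n} (hu : IsCompleteConvexTranslatorGraph γ r u ν)
    {x y : BaseSpace n} (hx : x ∈ ball 0 r) (hxy : ‖x‖ = ‖y‖) : u x = u y := by
  have key : ∀ x y : BaseSpace n, x ∈ ball 0 r → ‖x‖ = ‖y‖ → u x ≤ u y := by
    intro x y hx hxy
    rcases eq_or_ne x y with rfl | hne
    · exact le_rfl
    have hy : y ∈ ball (0 : BaseSpace n) r := by rwa [mem_ball_zero_iff, ← hxy, ← mem_ball_zero_iff]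
    have hd : 0 < ‖y - x‖ := norm_pos_iff.2 (sub_ne_zero.2 hne.symm)
    -- Equal norms put the origin on the bisector of `x` and `y`, so the reflection at height `0`
    -- maps `y` to `x`. It is reached as the limit of positive heights.
    set e := ‖y - x‖⁻¹ • (y - x) with he
    have he1 : ‖e‖ = 1 := by
      rw [he, norm_smul, norm_inv, norm_norm, inv_mul_cancel₀ hd.ne']
    have hey : inner ℝ e y = ‖y - x‖ / 2 := by
      have h1 := norm_sub_sq_real y x
      have h2 : inner ℝ (y - x) y = ‖y - x‖ ^ 2 / 2 := by
        rw [inner_sub_left, real_inner_self_eq_norm_sq, real_inner_comm, h1, hxy]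
        ring
      rw [he, real_inner_smul_left, h2]
      field_simp
    have hcont : Tendsto (fun t : ℝ => u (y - (2 * (inner ℝ e y - t)) • e)) (𝓝[>] 0) (𝓝 (u x)) := by
      have h1 : y - (2 * (inner ℝ e y - 0)) • e = x := by
        rw [hey, he, smul_smul]
        have : 2 * (‖y - x‖ / 2 - 0) * ‖y - x‖⁻¹ = 1 := by field_simp; ring
        rw [this, one_smul, sub_sub_cancel]
      have h2 : ContinuousAt (fun t : ℝ => u (y - (2 * (inner ℝ e y - t)) • e)) 0 := by
        refine ContinuousAt.comp (g := u) ?_ (by fun_prop)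
        rw [h1]
        exact (hu.isTranslatorAt hγ x hx).1.continuousAt
      have h3 := h2.tendsto
      rw [h1] at h3
      exact h3.mono_left nhdsWithin_le_nhds
    refine le_of_tendsto hcont ?_
    have hpos : 0 < inner ℝ e y := by rw [hey]; positivity
    filter_upwards [Ioc_mem_nhdsGT hpos] with t ht
    exact hu.reflect_le hα hγ he1 ht.1 hy ht.2
  refine le_antisymm (key x y hx hxy) (key y x ?_ hxy.symm)
  rwa [mem_ball_zero_iff, ← hxy, ← mem_ball_zero_iff]

/-! ### Uniqueness of the radius and of the profile. -/

/-- The radius of the ball is determined by the curvature function. -/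
lemma IsCompleteConvexTranslatorGraph.radius_le {n : ℕ} {γ : (Fin n → ℝ) → ℝ} {α : ℝ}
    (hα : 0 < α) (hγ : IsCurvatureFunction γ α) {r R : ℝ} {u w : BaseSpace n → ℝ}
    {ν μ : BaseSpace n → AmbientSpace n} (hu : IsCompleteConvexTranslatorGraph γ r u ν)
    (hw : IsCompleteConvexTranslatorGraph γ R w μ) : r ≤ R := by
  by_contra! hlt
  obtain ⟨C, hC⟩ := IsTranslatorAt.exists_forall_closedBall_le (hu.isTranslatorAt hγ) hlt
  -- The constant makes `w - u` near the boundary exceed its value at the center by `1`, which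
  -- comparison forbids.
  obtain ⟨ρ₀, hρ₀, hρ⟩ := hw.exists_radius_forall_lt hγ (w 0 - u 0 + 1 + C)
  have hρ0 : 0 ≤ max ρ₀ 0 := le_max_right _ _
  have hρR : max ρ₀ 0 < R := max_lt hρ₀ hw.radius_pos
  have := le_sub_of_le_sub_boundary hα hγ (hw.isTranslatorAt hγ) (hu.isTranslatorAt hγ)
    (LinearIsometryEquiv.refl ℝ _) 0 (K := closedBall 0 (max ρ₀ 0)) (m := w 0 - u 0 + 1)
    (x := 0) (isCompact_closedBall _ _) (closedBall_subset_ball hρR)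
    (fun y hy => by simpa using closedBall_subset_ball (hρR.trans hlt) hy) (fun y hy => ?_)
    (mem_closedBall_self hρ0)
  · simp only [map_zero, add_zero] at this
    linarith
  · have h1 := hρ y (closedBall_subset_ball hρR hy.1)
      ((le_max_left _ _).trans (norm_eq_of_mem_closedBall_diff_interior hy).ge)
    have h2 := hC y (closedBall_subset_closedBall hρR.le hy.1)
    simp only [LinearIsometryEquiv.coe_refl, id_eq, add_zero]
    linarith

/-- By rotational symmetry `u - w` equals `u x - w x` on the whole sphere through `x`, and
comparison carries this lower bound to the center. -/
lemma IsCompleteConvexTranslatorGraph.sub_le_sub {n : ℕ} {γ : (Fin n → ℝ) → ℝ} {α : ℝ}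
    (hα : 0 < α) (hγ : IsCurvatureFunction γ α) {r : ℝ} {u w : BaseSpace n → ℝ}
    {ν μ : BaseSpace n → AmbientSpace n} (hu : IsCompleteConvexTranslatorGraph γ r u ν)
    (hw : IsCompleteConvexTranslatorGraph γ r w μ) {x : BaseSpace n} (hx : x ∈ ball 0 r) :
    u x - w x ≤ u 0 - w 0 := by
  have hxr : ‖x‖ < r := mem_ball_zero_iff.1 hx
  have := le_sub_of_le_sub_boundary hα hγ (hu.isTranslatorAt hγ) (hw.isTranslatorAt hγ)
    (LinearIsometryEquiv.refl ℝ _) 0 (K := closedBall 0 ‖x‖) (m := u x - w x)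
    (x := 0) (isCompact_closedBall _ _) (closedBall_subset_ball hxr)
    (fun y hy => by simpa using closedBall_subset_ball hxr hy) (fun y hy => ?_)
    (mem_closedBall_self (norm_nonneg x))
  · simpa using this
  · have h1 := (norm_eq_of_mem_closedBall_diff_interior hy).symm
    simp only [LinearIsometryEquiv.coe_refl, id_eq, add_zero]
    rw [hu.eq_of_norm_eq hα hγ hx h1, hw.eq_of_norm_eq hα hγ hx h1]

lemma ambientPoint_add_smul_verticalVec {n : ℕ} (x : BaseSpace n) (t c : ℝ) :
    ambientPoint x t + c • verticalVec n = ambientPoint x (t + c) := by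
  ext i
  refine Fin.lastCases ?_ (fun j => ?_) i
  · simp [ambientPoint, verticalVec]
  · simp [ambientPoint, verticalVec, (Fin.castSucc_lt_last j).ne]

theorem corollary1p5 {n : ℕ} (γ : (Fin n → ℝ) → ℝ) (α : ℝ) (hα : 1 / 2 < α)
    (hγ : IsCurvatureFunction γ α)
    (r : ℝ) (u : BaseSpace n → ℝ) (ν : BaseSpace n → AmbientSpace n)
    (hu : IsCompleteConvexTranslatorGraph γ r u ν)
    (hend : HasSingleEnd (graphOverBall r u))
    (hcyl : IsAsymptoticToCylinder r u ν)
    (R : ℝ) (w : BaseSpace n → ℝ) (hw : IsBowlOverBall γ R w) :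
    ∃ c : ℝ, graphOverBall r u = verticalTranslate c (graphOverBall R w) := by

  obtain ⟨⟨μ, hw⟩, -⟩ := hw
  have hα₀ : 0 < α := by linarith
  obtain rfl : r = R := le_antisymm (hu.radius_le hα₀ hγ hw) (hw.radius_le hα₀ hγ hu)
  refine ⟨u 0 - w 0, ?_⟩
  have heq : ∀ x ∈ ball (0 : BaseSpace n) r, u x = w x + (u 0 - w 0) := by
    intro x hx
    have h1 := hu.sub_le_sub hα₀ hγ hw hx
    have h2 := hw.sub_le_sub hα₀ hγ hu hx
    linarith
  rw [verticalTranslate, graphOverBall, graphOverBall, image_image]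
  refine image_congr fun x hx => ?_
  rw [graphMap, graphMap, ambientPoint_add_smul_verticalVec, heq x hx]
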